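/- For a real $n\times n$ matrix $A=[a_{ij}]$ let $S_{|A|_\circ}$ be the set of all real $\alpha\ge 0$ for which the matrix $[|a_{ij}|^\alpha]$ is positive semi-definite (with the convention $0^0=1$). For $n\ge 4$ and $\epsilon>0$ let $C_{n,\epsilon}=C_n+\epsilon I_n$, where $C_n=[\cos((i-j)\pi/n)]_{0\le i,j\le n-1}$ and $I_n$ is the identity matrix. Fix an integer $n\ge 4$, and let $K_n=\{2,4,\dots,n-2\}$ if $n$ is even and $K_n=\{2,4,\dots,n-3\}$ if $n$ is odd. Then there is $\epsilon_0>0$, depending only on $n$, such that for every $\epsilon$ with $0<\epsilon<\epsilon_0$: 1. there exists $\delta>0$ such that $[k-\delta,k+\delta]\subset S_{|C_{n,\epsilon}|_\circ}$ for every $k\in K_n$; 2. $k-1\notin S_{|C_{n,\epsilon}|_\circ}$ for every $k\in K_n$. -/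

import Mathlib

/-- The entrywise power `|A|_∘^{∘ α} = [|a_ij|^α]` of a real matrix; `Real.rpow` has `0 ^ 0 = 1`. -/
noncomputable def absHadamardPow {n : ℕ} (A : Matrix (Fin n) (Fin n) ℝ) (α : ℝ) :
    Matrix (Fin n) (Fin n) ℝ :=
  Matrix.of fun i j => |A i j| ^ α

/-- The set `S_{|A|_∘}` of all `α ≥ 0` for which `[|a_ij|^α]` is positive semi-definite. -/
def absPowerSet {n : ℕ} (A : Matrix (Fin n) (Fin n) ℝ) : Set ℝ :=
  {α | 0 ≤ α ∧ (absHadamardPow A α).PosSemidef}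

/-- The matrix `C_n = [cos ((i - j) π / n)]`, with `0 ≤ i, j ≤ n - 1`. -/
noncomputable def cosMatrix (n : ℕ) : Matrix (Fin n) (Fin n) ℝ :=
  Matrix.of fun i j => Real.cos ((((i : ℕ) : ℝ) - ((j : ℕ) : ℝ)) * Real.pi / (n : ℝ))

/-- The matrix `C_{n,ε} = C_n + ε I_n`. -/
noncomputable def cosMatrixPerturbed (n : ℕ) (ε : ℝ) : Matrix (Fin n) (Fin n) ℝ :=
  cosMatrix n + ε • (1 : Matrix (Fin n) (Fin n) ℝ)

/-- The even integers `2, 4, …, n - 2` if `n` is even, and `2, 4, …, n - 3` if `n` is odd. -/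
def evenExponents (n : ℕ) : Set ℕ :=
  {k | Even k ∧ 2 ≤ k ∧ k ≤ if Even n then n - 2 else n - 3}

/-! For even `k`, `|C_{n,ε}|^k` is the Hadamard power `C_n^{∘k}`, which is positive semidefinite,
plus a positive multiple of the identity. This slack absorbs a small change of exponent.

For `k - 1`, multiply entrywise by `C_{n,ε}^{∘(n-2-k)}`. By the Schur product theorem it suffices
that `[|a| a^(n-4)]`, which no longer involves `k`, is not semidefinite. The alternating vector
shows this at `ε = 0`, and continuity extends it to small `ε`. There the form is `n` times the
alternating sum of `|c_j| c_j^(n-4)`, where `c_j = cos (jπ/n)`. Interpolation rewrites the summand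
as a polynomial in `c_j` of degree at most `n` and the parity of `n`. Only its `c^n` term survives
summation, and Rolle's theorem makes that coefficient negative. -/

/-! ### Alternating power sums of cosines -/

open Finset in
theorem sum_neg_one_pow_mul_cos_pow {n : ℕ} (hn : n ≠ 0) {b s : ℕ} (hb : n = b + 2 * s) :
    (∑ j ∈ range n, (-1 : ℂ) ^ j * (Real.cos (j * Real.pi / n) : ℂ) ^ b) * 2 ^ b =
      ∑ i ∈ range (b + 1), (b.choose i : ℂ) *
        ∑ j ∈ range n, (Complex.exp (2 * Real.pi * Complex.I / n) ^ (s + i)) ^ j := by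
  set ω := Complex.exp (2 * Real.pi * Complex.I / n)
  -- With `z = exp (ijπ/n)`, the sign is `z ^ n = z ^ b * z ^ (2 * s)`, and `z ^ b` turns `(2 cos) ^
  -- b` into `(z ^ 2 + 1) ^ b`.
  have hterm (j : ℕ) : (-1 : ℂ) ^ j * (Real.cos (j * Real.pi / n) : ℂ) ^ b * 2 ^ b =
      (ω ^ j) ^ s * (ω ^ j + 1) ^ b := by
    set z := Complex.exp ((j * Real.pi / n : ℝ) * Complex.I) with hz
    have hz0 : z ≠ 0 := Complex.exp_ne_zero _
    have hn' : (n : ℂ) ≠ 0 := by exact_mod_cast hn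
    have h1 : ω ^ j = z ^ 2 := by
      rw [hz, ← Complex.exp_nat_mul, ← Complex.exp_nat_mul]
      congr 1
      push_cast
      field_simp
    have h2 : z ^ n = (-1) ^ j := by
      rw [hz, ← Complex.exp_nat_mul, ← Complex.exp_pi_mul_I, ← Complex.exp_nat_mul]
      congr 1
      push_cast
      field_simp
    have h3 : z ^ 2 + 1 = z * ((Real.cos (j * Real.pi / n) : ℂ) * 2) := by
      rw [Complex.ofReal_cos, Complex.cos, neg_mul, Complex.exp_neg, ← hz]
      field_simp
    rw [h1, h3, ← h2, hb]
    ring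
  rw [sum_mul, sum_congr rfl fun j _ => hterm j]
  simp_rw [add_pow, one_pow, mul_one, mul_sum]
  rw [sum_comm]
  refine sum_congr rfl fun i _ => sum_congr rfl fun j _ => ?_
  ring

theorem sum_range_exp_pow_eq_zero {n t : ℕ} (ht : 0 < t) (htn : t < n) :
    ∑ j ∈ Finset.range n, (Complex.exp (2 * Real.pi * Complex.I / n) ^ t) ^ j = 0 := by
  have hω := Complex.isPrimitiveRoot_exp n (by omega)
  have h1 : Complex.exp (2 * Real.pi * Complex.I / n) ^ t ≠ 1 :=
    hω.pow_ne_one_of_pos_of_lt ht.ne' htn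
  rw [geom_sum_eq h1, ← pow_mul, mul_comm t, pow_mul, hω.pow_eq_one]
  simp

/-- The alternating power sums of `cos (jπ/n)` vanish for exponents `0 < b < n` with the parity
of `n`. -/
theorem sum_neg_one_pow_mul_cos_pow_eq_zero {n b s : ℕ} (hb : n = b + 2 * s) (hb0 : 0 < b)
    (hs : 0 < s) :
    ∑ j ∈ Finset.range n, (-1 : ℝ) ^ j * Real.cos (j * Real.pi / n) ^ b = 0 := by
  have h := sum_neg_one_pow_mul_cos_pow (by omega) hb
  rw [Finset.sum_eq_zero (s := Finset.range (b + 1))] at h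
  · have h' := (mul_eq_zero.mp h).resolve_right (pow_ne_zero _ two_ne_zero)
    exact_mod_cast h'
  · intro i hi
    rw [Finset.mem_range] at hi
    rw [sum_range_exp_pow_eq_zero (by omega) (by omega), mul_zero]

/-- Of the binomial terms only `i = 0` and `i = n` give nonvanishing root-of-unity sums, each equal
to `n`. -/
theorem sum_neg_one_pow_mul_cos_pow_self_pos {n : ℕ} (hn : 0 < n) :
    0 < ∑ j ∈ Finset.range n, (-1 : ℝ) ^ j * Real.cos (j * Real.pi / n) ^ n := by
  have h := sum_neg_one_pow_mul_cos_pow hn.ne' (show n = n + 2 * 0 by simp)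
  have hω := Complex.isPrimitiveRoot_exp n hn.ne'
  obtain ⟨m, rfl⟩ : ∃ m, n = m + 1 := ⟨n - 1, by omega⟩
  have hsum : ∑ i ∈ Finset.range (m + 1 + 1), ((m + 1).choose i : ℂ) *
      ∑ j ∈ Finset.range (m + 1),
        (Complex.exp (2 * Real.pi * Complex.I / (m + 1 : ℕ)) ^ (0 + i)) ^ j =
      2 * ((m + 1 : ℕ) : ℂ) := by
    rw [Finset.sum_range_succ, Finset.sum_range_succ', Finset.sum_eq_zero, zero_add, zero_add, zero_add,
      hω.pow_eq_one]
    · simp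
      ring
    · intro i hi
      rw [Finset.mem_range] at hi
      rw [sum_range_exp_pow_eq_zero (by omega) (by omega), mul_zero]
  have h' : (∑ j ∈ Finset.range (m + 1), (-1 : ℝ) ^ j *
      Real.cos (j * Real.pi / (m + 1 : ℕ)) ^ (m + 1)) * 2 ^ (m + 1) = 2 * (m + 1 : ℕ) := by
    exact_mod_cast h.trans hsum
  have h2 : (0 : ℝ) < 2 ^ (m + 1) := by positivity
  refine pos_of_mul_pos_left ?_ h2.le
  rw [h']
  positivity

/-! ### Interpolation and the sign of the leading coefficient -/

open Polynomial in
/-- If a polynomial of degree at most `N + 1` agrees with `c x ^ (N - 1/2)`, `c > 0`, at `N + 2`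
positive points, then its leading coefficient is negative. -/
theorem coeff_neg_of_eval_eq_rpow (N : ℕ) : ∀ (p : ℝ[X]) (c : ℝ) (x : ℕ → ℝ), 0 < c →
    p.natDegree ≤ N + 1 → (∀ i ≤ N + 1, 0 < x i) → (∀ i ≤ N, x (i + 1) < x i) →
    (∀ i ≤ N + 1, p.eval (x i) = c * x i ^ ((N : ℝ) - 1 / 2)) → p.coeff (N + 1) < 0 := by
  have rolle (N : ℕ) (p : ℝ[X]) (c : ℝ) (x : ℕ → ℝ) (hx : ∀ i ≤ N + 1, 0 < x i)
      (hlt : ∀ i ≤ N, x (i + 1) < x i)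
      (hp : ∀ i ≤ N + 1, p.eval (x i) = c * x i ^ ((N : ℝ) - 1 / 2)) (i : ℕ) (hi : i ≤ N) :
      ∃ y ∈ Set.Ioo (x (i + 1)) (x i),
        p.derivative.eval y - c * (((N : ℝ) - 1 / 2) * y ^ ((N : ℝ) - 1 / 2 - 1)) = 0 := by
    have hder (y : ℝ) (hy : x (i + 1) ≤ y) : HasDerivAt
        (fun y => p.eval y - c * y ^ ((N : ℝ) - 1 / 2))
        (p.derivative.eval y - c * (((N : ℝ) - 1 / 2) * y ^ ((N : ℝ) - 1 / 2 - 1))) y :=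
      (p.hasDerivAt y).sub ((Real.hasDerivAt_rpow_const
        (Or.inl ((hx (i + 1) (by omega)).trans_le hy).ne')).const_mul c)
    refine exists_hasDerivAt_eq_zero (hlt i hi)
      (fun y hy => (hder y hy.1).continuousAt.continuousWithinAt) ?_
      (fun y hy => hder y hy.1.le)
    simp only [hp i (by omega), hp (i + 1) (by omega), sub_self]
  -- Each derivative loses one node and lowers the exponent by one, with a positive factor until the
  -- exponent is `-1/2`. The last derivative brings the negative sign.
  induction N with
  | zero =>
    intro p c x hc hdeg hx hlt hp
    obtain ⟨y, hy, h⟩ := rolle 0 p c x hx hlt hp 0 le_rfl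
    have hy0 : 0 < y := (hx 1 (by omega)).trans hy.1
    have hd : p.derivative.natDegree = 0 := by
      have := natDegree_derivative_le p
      omega
    rw [eq_C_of_natDegree_eq_zero hd, eval_C, coeff_derivative] at h
    have : 0 < c * y ^ (((0 : ℕ) : ℝ) - 1 / 2 - 1) := by positivity
    norm_num at h this ⊢
    nlinarith
  | succ N ih =>
    intro p c x hc hdeg hx hlt hp
    choose! y hy h using rolle (N + 1) p c x hx hlt hp
    have := ih p.derivative (c * ((N : ℝ) + 1 / 2)) y (by positivity)
      ((natDegree_derivative_le p).trans (by omega))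
      (fun i hi => (hx (i + 1) (by omega)).trans (hy i hi).1)
      (fun i hi => (hy (i + 1) (by omega)).2.trans (hy i (by omega)).1)
      (fun i hi => by
        have := h i hi
        push_cast at this
        rw [show (N : ℝ) + 1 - 1 / 2 - 1 = N - 1 / 2 by ring] at this
        linear_combination this)
    rw [coeff_derivative] at this
    exact neg_of_mul_neg_left this (by positivity)

theorem pow_mul_sq_rpow_sub_half {N r n : ℕ} (hr : r ≠ 0) (hn : 4 ≤ n) (hnr : n = 2 * (N + 1) + r)
    (c : ℝ) : c ^ r * (c ^ 2) ^ ((N : ℝ) - 1 / 2) = |c| * c ^ (n - 4) := by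
  rcases eq_or_ne c 0 with rfl | hc
  · simp [hr]
  have hx : 0 < c ^ 2 := by positivity
  have h : (c ^ 2) ^ ((N : ℝ) - 1 / 2) * c ^ 2 = c ^ (2 * N) * |c| := by
    rw [← Real.rpow_add_one hx.ne', show (N : ℝ) - 1 / 2 + 1 = N + 1 / 2 by ring,
      Real.rpow_add hx, Real.rpow_natCast, ← Real.sqrt_eq_rpow, Real.sqrt_sq_eq_abs, pow_mul]
  have h4 : c ^ n = c ^ (n - 4) * c ^ 4 := by rw [← pow_add, Nat.sub_add_cancel hn]
  have hn' : c ^ n = c ^ (2 * N) * c ^ 2 * c ^ r := by rw [← pow_add, ← pow_add, hnr]; congr 1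
  refine mul_right_cancel₀ (pow_ne_zero 4 hc) ?_
  linear_combination c ^ r * c ^ 2 * h - |c| * hn' + |c| * h4

open Polynomial in
theorem exists_polynomial_eval_eq_rpow (N : ℕ) (x : ℕ → ℝ) (hx : ∀ i ≤ N + 1, 0 < x i)
    (hlt : ∀ i j, i < j → j ≤ N + 1 → x j < x i) :
    ∃ p : ℝ[X], p.natDegree < N + 2 ∧ (∀ i ≤ N + 1, p.eval (x i) = x i ^ ((N : ℝ) - 1 / 2)) ∧
      p.coeff (N + 1) < 0 := by
  have hinj : Set.InjOn x (Finset.range (N + 2) : Set ℕ) := by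
    intro i hi j hj hij
    simp only [Finset.coe_range, Set.mem_Iio] at hi hj
    rcases lt_trichotomy i j with h | h | h
    · exact absurd hij (hlt i j h (by omega)).ne'
    · exact h
    · exact absurd hij (hlt j i h (by omega)).ne
  have hdeg := Lagrange.degree_interpolate_le (fun j => x j ^ ((N : ℝ) - 1 / 2)) hinj
  have heval (i : ℕ) (hi : i ≤ N + 1) :=
    Lagrange.eval_interpolate_at_node (fun j => x j ^ ((N : ℝ) - 1 / 2)) hinj
      (Finset.mem_range.mpr (by omega : i < N + 2))
  rw [Finset.card_range] at hdeg
  have hdeg' := natDegree_le_of_degree_le hdeg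
  refine ⟨_, by omega, heval, ?_⟩
  refine coeff_neg_of_eval_eq_rpow N _ 1 x one_pos hdeg' hx
    (fun i hi => hlt i (i + 1) (by omega) (by omega)) fun i hi => ?_
  rw [heval i hi, one_mul]

theorem sum_neg_one_pow_mul_abs_cos_mul_cos_pow_neg {n : ℕ} (hn : 4 ≤ n) :
    ∑ j ∈ Finset.range n, (-1 : ℝ) ^ j *
      (|Real.cos (j * Real.pi / n)| * Real.cos (j * Real.pi / n) ^ (n - 4)) < 0 := by
  -- Here `r` is 1 or 2 by the parity of `n`. The positive cosines are then exactly those with `j ≤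
  -- N + 1`, and `r ≠ 0` takes care of a vanishing cosine.
  obtain ⟨N, r, hr, hr2, hnr⟩ : ∃ N r : ℕ, 0 < r ∧ r ≤ 2 ∧ n = 2 * (N + 1) + r :=
    ⟨(n - 3) / 2, n - 2 * ((n - 3) / 2 + 1), by omega, by omega, by omega⟩
  have hn0 : (0 : ℝ) < n := by positivity
  set c : ℕ → ℝ := fun j => Real.cos (j * Real.pi / n) with hc
  have hcpos (j : ℕ) (hj : j ≤ N + 1) : 0 < c j := by
    refine Real.cos_pos_of_mem_Ioo ⟨?_, ?_⟩
    · have : 0 ≤ j * Real.pi / n := by positivity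
      linarith [Real.pi_pos]
    · have : (2 * j : ℝ) < n := by exact_mod_cast (by omega : 2 * j < n)
      rw [div_lt_div_iff₀ hn0 two_pos]
      nlinarith [Real.pi_pos]
  have hclt (i j : ℕ) (hij : i < j) (hj : j ≤ N + 1) : c j < c i := by
    refine Real.cos_lt_cos_of_nonneg_of_le_pi (by positivity) ?_ ?_
    · rw [div_le_iff₀ hn0, mul_comm]
      gcongr
      omega
    · gcongr
  have hcsymm (j : ℕ) (hj : j ≤ n) : c (n - j) = -c j := by
    simp only [hc]
    rw [← Real.cos_pi_sub, Nat.cast_sub hj]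
    congr 1
    field_simp
  have hsqlt (i j : ℕ) (hij : i < j) (hj : j ≤ N + 1) : c j ^ 2 < c i ^ 2 :=
    pow_lt_pow_left₀ (hclt i j hij hj) (hcpos j hj).le two_ne_zero
  obtain ⟨p, hdeg, heval, hcoeff⟩ := exists_polynomial_eval_eq_rpow N (fun j => c j ^ 2)
    (fun i hi => pow_pos (hcpos i hi) 2) hsqlt
  have hterm (j : ℕ) (hj : j < n) :
      |c j| * c j ^ (n - 4) = c j ^ r * p.eval (c j ^ 2) := by
    rcases eq_or_ne (c j) 0 with h0 | h0
    · simp [h0, hr.ne']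
    rw [← pow_mul_sq_rpow_sub_half hr.ne' hn hnr]
    congr 1
    by_cases hjN : j ≤ N + 1
    · rw [heval j hjN]
    · have hs := hcsymm j hj.le
      have hsq : c j ^ 2 = c (n - j) ^ 2 := by rw [hs, neg_sq]
      rw [hsq, heval]
      by_contra hlt
      have : n - j = j := by omega
      rw [this] at hs
      exact h0 (by linarith)
  calc ∑ j ∈ Finset.range n, (-1 : ℝ) ^ j * (|c j| * c j ^ (n - 4))
      = ∑ i ∈ Finset.range (N + 2),
          p.coeff i * ∑ j ∈ Finset.range n, (-1 : ℝ) ^ j * c j ^ (r + 2 * i) := by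
        simp_rw [Finset.mul_sum]
        rw [Finset.sum_comm]
        refine Finset.sum_congr rfl fun j hj => ?_
        rw [hterm j (Finset.mem_range.mp hj), Polynomial.eval_eq_sum_range' hdeg]
        simp_rw [Finset.mul_sum]
        refine Finset.sum_congr rfl fun i _ => ?_
        rw [pow_add, pow_mul]
        ring
    _ = p.coeff (N + 1) * ∑ j ∈ Finset.range n, (-1 : ℝ) ^ j * c j ^ n := by
        rw [Finset.sum_range_succ, Finset.sum_eq_zero, zero_add, hnr, add_comm r]
        intro i hi
        rw [Finset.mem_range] at hi
        rw [sum_neg_one_pow_mul_cos_pow_eq_zero (s := N + 1 - i) (by omega) (by omega)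
          (by omega), mul_zero]
    _ < 0 := mul_neg_of_neg_of_pos hcoeff (sum_neg_one_pow_mul_cos_pow_self_pos (by omega))

/-! ### The quadratic form at the alternating vector -/

theorem sum_range_sub_of_periodic {n : ℕ} {H : ℤ → ℝ} (hH : Function.Periodic H (n : ℤ)) (i : ℕ) :
    ∑ j ∈ Finset.range n, H (j - i) = ∑ j ∈ Finset.range n, H j := by
  induction i with
  | zero => simp
  | succ i ih =>
    rw [← ih]
    have h1 := Finset.sum_range_succ' (fun j : ℕ => H (j - (i + 1 : ℕ))) n
    rw [Finset.sum_range_succ] at h1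
    have h2 : H (n - (i + 1 : ℕ)) = H ((0 : ℕ) - (i + 1 : ℕ)) := by
      rw [← hH ((0 : ℕ) - (i + 1 : ℕ))]; congr 1
    rw [h2] at h1
    rw [add_right_cancel h1]
    refine Finset.sum_congr rfl fun j _ => ?_
    congr 1; push_cast; ring

theorem sum_sum_neg_one_pow_cosMatrix_neg {n : ℕ} (hn : 4 ≤ n) :
    ∑ i : Fin n, ∑ j : Fin n, (-1 : ℝ) ^ (i : ℕ) *
      (|cosMatrix n i j| * cosMatrix n i j ^ (n - 4)) * (-1) ^ (j : ℕ) < 0 := by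
  have hn0 : (n : ℝ) ≠ 0 := by positivity
  set H : ℤ → ℝ := fun d => (-1) ^ d *
    (|Real.cos (d * Real.pi / n)| * Real.cos (d * Real.pi / n) ^ (n - 4)) with hHdef
  -- A shift by `n` changes the two factors by `(-1) ^ n` and `(-1) ^ (n - 4)`, which cancel; hence
  -- all row sums agree.
  have hH : Function.Periodic H (n : ℤ) := by
    intro d
    have h : ((d + (n : ℤ) : ℤ) : ℝ) * Real.pi / n = d * Real.pi / n + Real.pi := by
      push_cast
      field_simp
    have h1 : (-1 : ℝ) ^ n * (-1) ^ (n - 4) = 1 := by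
      rw [← pow_add, Even.neg_one_pow ⟨n - 2, by omega⟩]
    simp only [hHdef]
    rw [h, Real.cos_add_pi, abs_neg, zpow_add₀ (by norm_num), zpow_natCast, neg_pow (Real.cos _)]
    linear_combination (-1) ^ d * |Real.cos (d * Real.pi / n)| *
      Real.cos (d * Real.pi / n) ^ (n - 4) * h1
  have hterm (i j : Fin n) : (-1 : ℝ) ^ (i : ℕ) *
      (|cosMatrix n i j| * cosMatrix n i j ^ (n - 4)) * (-1) ^ (j : ℕ) =
      H ((j : ℕ) - (i : ℕ)) := by
    simp only [hHdef, cosMatrix, Matrix.of_apply]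
    have hcos : Real.cos (((j : ℕ) - (i : ℕ) : ℤ) * Real.pi / n) =
        Real.cos (((i : ℕ) - (j : ℕ)) * Real.pi / n) := by
      rw [← Real.cos_neg]
      congr 1
      push_cast
      ring
    rw [hcos, zpow_sub₀ (by norm_num), zpow_natCast, zpow_natCast]
    rcases neg_one_pow_eq_or ℝ (i : ℕ) with h | h <;> rw [h] <;> ring
  have hsum := sum_neg_one_pow_mul_abs_cos_mul_cos_pow_neg hn
  refine Finset.sum_neg (fun i _ => ?_) ⟨⟨0, by omega⟩, Finset.mem_univ _⟩
  simp_rw [hterm]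
  rw [Fin.sum_univ_eq_sum_range (fun j : ℕ => H (j - (i : ℕ))), sum_range_sub_of_periodic hH]
  simpa [hHdef] using hsum

/-! ### Positive semidefiniteness and perturbation -/

open Matrix

theorem cosMatrix_posSemidef (n : ℕ) : (cosMatrix n).PosSemidef := by
  have h := (posSemidef_vecMulVec_self_star
      (fun i : Fin n => Real.cos ((i : ℕ) * Real.pi / n))).add
    (posSemidef_vecMulVec_self_star (fun i : Fin n => Real.sin ((i : ℕ) * Real.pi / n)))
  convert h using 1
  ext i j
  simp only [cosMatrix, of_apply, Matrix.add_apply, vecMulVec_apply, star_trivial]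
  rw [← Real.cos_sub]
  congr 1
  ring

theorem Matrix.PosSemidef.hadamard_pow {ι : Type*} [Fintype ι] {A : Matrix ι ι ℝ}
    (hA : A.PosSemidef) (m : ℕ) : (Matrix.of fun i j => A i j ^ m).PosSemidef := by
  induction m with
  | zero =>
    convert posSemidef_vecMulVec_self_star (fun _ : ι => (1 : ℝ)) using 1
    ext i j
    simp [vecMulVec_apply]
  | succ m ih =>
    have h : (of fun i j => A i j ^ (m + 1)) = (of fun i j => A i j ^ m) ⊙ A := by
      ext i j
      simp [pow_succ]
    rw [h]
    exact ih.hadamard hA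

theorem dotProduct_mulVec_eq_sum_sum {ι : Type*} [Fintype ι] (A : Matrix ι ι ℝ) (x : ι → ℝ) :
    x ⬝ᵥ (A *ᵥ x) = ∑ i, ∑ j, x i * A i j * x j := by
  simp [dotProduct, mulVec, Finset.mul_sum, mul_assoc]

/-- A symmetric matrix entrywise close to `P + c`, with `P` positive semidefinite and `c > 0`, is
positive semidefinite. -/
theorem Matrix.PosSemidef.of_abs_sub_le {ι : Type*} [Fintype ι] [DecidableEq ι]
    {P D : Matrix ι ι ℝ} (hP : P.PosSemidef) (hD : D.IsHermitian) {c η : ℝ}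
    (hη : Fintype.card ι * η ≤ c) (h : ∀ i j, |D i j - (P + c • (1 : Matrix ι ι ℝ)) i j| ≤ η) :
    D.PosSemidef := by
  refine .of_dotProduct_mulVec_nonneg hD fun x => ?_
  have hPx := hP.dotProduct_mulVec_nonneg x
  rw [star_trivial, dotProduct_mulVec_eq_sum_sum] at hPx ⊢
  have h1 : ∀ i j, x i * P i j * x j + (if i = j then c * x i ^ 2 else 0)
      - η / 2 * (x i ^ 2 + x j ^ 2) ≤ x i * D i j * x j := by
    intro i j
    have hij := abs_le.mp (h i j)
    set e := D i j - (P + c • (1 : Matrix ι ι ℝ)) i j with he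
    have heq : x i * D i j * x j = x i * P i j * x j + (if i = j then c * x i ^ 2 else 0)
        + e * (x i * x j) := by
      simp only [he, Matrix.add_apply, Matrix.smul_apply, Matrix.one_apply, smul_eq_mul]
      split_ifs with hij'
      · subst hij'; ring
      · ring
    rw [heq]
    -- Since `|e| ≤ η`, the error `e * x i * x j` is at least `-η / 2 * (x i ^ 2 + x j ^ 2)`.
    nlinarith [mul_nonneg (sub_nonneg.mpr hij.2) (sq_nonneg (x i - x j)),
      mul_nonneg (by linarith [hij.1] : 0 ≤ e + η) (sq_nonneg (x i + x j))]
  have h2 := Finset.sum_le_sum fun i (_ : i ∈ Finset.univ) =>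
    Finset.sum_le_sum fun j (_ : j ∈ Finset.univ) => h1 i j
  refine le_trans ?_ h2
  simp only [Finset.sum_sub_distrib, Finset.sum_add_distrib, Finset.sum_ite_eq, Finset.mem_univ,
    if_true, ← Finset.mul_sum, Finset.sum_const, Finset.card_univ, nsmul_eq_mul]
  have h3 : 0 ≤ ∑ i, x i ^ 2 := Finset.sum_nonneg fun i _ => sq_nonneg _
  nlinarith

theorem cosMatrixPerturbed_apply (n : ℕ) (ε : ℝ) (i j : Fin n) :
    cosMatrixPerturbed n ε i j = cosMatrix n i j + if i = j then ε else 0 := by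
  simp [cosMatrixPerturbed, Matrix.one_apply]

theorem cosMatrix_self (n : ℕ) (i : Fin n) : cosMatrix n i i = 1 := by simp [cosMatrix]

theorem cosMatrixPerturbed_posSemidef (n : ℕ) {ε : ℝ} (hε : 0 ≤ ε) :
    (cosMatrixPerturbed n ε).PosSemidef :=
  (cosMatrix_posSemidef n).add (PosSemidef.one.smul hε)

theorem absHadamardPow_isHermitian {n : ℕ} {A : Matrix (Fin n) (Fin n) ℝ} (hA : A.IsHermitian)
    (α : ℝ) : (absHadamardPow A α).IsHermitian := by
  ext i j
  have := hA.apply i j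
  simp only [star_trivial] at this
  simp [absHadamardPow, this]

theorem exists_Icc_subset_absPowerSet {n k : ℕ} (hk : Even k) (hk0 : 2 ≤ k) {ε : ℝ} (hε : 0 < ε) :
    ∃ δ : ℝ, 0 < δ ∧
      Set.Icc ((k : ℝ) - δ) ((k : ℝ) + δ) ⊆ absPowerSet (cosMatrixPerturbed n ε) := by
  set A := cosMatrixPerturbed n ε with hA
  have hk0' : (2 : ℝ) ≤ k := by exact_mod_cast hk0
  set c : ℝ := (1 + ε) ^ k - 1 with hc
  have hcpos : 0 < c := sub_pos.mpr (one_lt_pow₀ (by linarith) (by omega))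
  set η : ℝ := c / (n + 1) with hη
  have hηpos : 0 < η := by positivity
  have hev : ∀ᶠ α : ℝ in nhds (k : ℝ), ∀ i j, |(|A i j| ^ α - |A i j| ^ (k : ℝ))| < η := by
    simp only [Filter.eventually_all]
    intro i j
    have hcont : ContinuousAt (fun α : ℝ => |A i j| ^ α) k := by
      -- Entries may be zero, so continuity in the exponent relies on `k ≠ 0`.
      exact Real.continuousAt_const_rpow' (by positivity)
    exact (Metric.tendsto_nhds.mp hcont η hηpos)
  obtain ⟨δ, hδ, hball⟩ := Metric.eventually_nhds_iff.mp hev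
  refine ⟨min (δ / 2) 1, by positivity, fun α hα => ⟨?_, ?_⟩⟩
  · linarith [hα.1, min_le_right (δ / 2) 1]
  refine ((cosMatrix_posSemidef n).hadamard_pow k).of_abs_sub_le (c := c) (η := η)
    (absHadamardPow_isHermitian (cosMatrixPerturbed_posSemidef n hε.le).isHermitian α) ?_ ?_
  · rw [Fintype.card_fin, hη, mul_div_assoc', div_le_iff₀ (by positivity)]
    nlinarith
  · intro i j
    have hdist : dist α k < δ := by
      rw [Real.dist_eq, abs_lt]
      constructor <;> linarith [hα.1, hα.2, min_le_left (δ / 2) 1]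
    have hentry : (Matrix.of (fun i j => cosMatrix n i j ^ k) +
        c • (1 : Matrix (Fin n) (Fin n) ℝ)) i j = |A i j| ^ (k : ℝ) := by
      rw [Real.rpow_natCast, hk.pow_abs, hA, cosMatrixPerturbed_apply]
      by_cases hij : i = j
      · subst hij
        simp [cosMatrix_self, hc]
      · simp [hij]
    rw [hentry]
    exact (hball hdist i j).le

theorem evenExponents_finite (n : ℕ) : (evenExponents n).Finite := by
  refine (Set.finite_Iic n).subset fun k hk => ?_
  have := hk.2.2
  simp only [Set.mem_Iic]
  split_ifs at this <;> omega

/-- The right side does not depend on `k`, so a single `ε₀` serves every exponent. Evenness of `k -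
2` lets all but one factor `|a|` lose the absolute value. -/
theorem abs_rpow_sub_one_mul_pow {n k : ℕ} (hk : k ∈ evenExponents n) (a : ℝ) :
    |a| ^ ((k : ℝ) - 1) * a ^ (n - 2 - k) = |a| * a ^ (n - 4) := by
  obtain ⟨hke, hk2, hkn⟩ := hk
  have hkn' : k ≤ n - 2 := by split_ifs at hkn <;> omega
  obtain ⟨m, rfl⟩ : ∃ m, k = m + 2 := ⟨k - 2, by omega⟩
  have hm : Even m := by simpa [Nat.even_add] using hke
  rw [show ((m + 2 : ℕ) : ℝ) - 1 = (m + 1 : ℕ) by push_cast; ring, Real.rpow_natCast, pow_succ,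
    hm.pow_abs, show n - 4 = m + (n - 2 - (m + 2)) by omega, pow_add]
  ring

theorem theorem1p2 (n : ℕ) (hn : 4 ≤ n) :
    ∃ ε₀ : ℝ, 0 < ε₀ ∧ ∀ ε : ℝ, 0 < ε → ε < ε₀ →
      (∃ δ : ℝ, 0 < δ ∧ ∀ k ∈ evenExponents n,
        Set.Icc ((k : ℝ) - δ) ((k : ℝ) + δ) ⊆ absPowerSet (cosMatrixPerturbed n ε)) ∧
      ∀ k ∈ evenExponents n, (k : ℝ) - 1 ∉ absPowerSet (cosMatrixPerturbed n ε) := by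
  set q : ℝ → ℝ := fun ε => ∑ i : Fin n, ∑ j : Fin n, (-1 : ℝ) ^ (i : ℕ) *
    (|cosMatrixPerturbed n ε i j| * cosMatrixPerturbed n ε i j ^ (n - 4)) * (-1) ^ (j : ℕ) with hq
  have hq0 : q 0 < 0 := by
    simpa [hq, cosMatrixPerturbed_apply] using sum_sum_neg_one_pow_cosMatrix_neg hn
  have hqc : Continuous q := by
    simp only [hq, cosMatrixPerturbed_apply]
    refine continuous_finsetSum _ fun i _ => continuous_finsetSum _ fun j _ => ?_
    split_ifs <;> fun_prop
  obtain ⟨ε₀, hε₀, hneg⟩ := Metric.eventually_nhds_iff.mp (hqc.continuousAt.eventually_lt_const hq0)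
  refine ⟨ε₀, hε₀, fun ε hε hεlt => ⟨?_, ?_⟩⟩
  · have hex : ∀ k ∈ evenExponents n, ∃ δ : ℝ, 0 < δ ∧
        Set.Icc ((k : ℝ) - δ) ((k : ℝ) + δ) ⊆ absPowerSet (cosMatrixPerturbed n ε) :=
      fun k hk => exists_Icc_subset_absPowerSet hk.1 hk.2.1 hε
    choose! d hd hsub using hex
    obtain ⟨δ, hδ, hle⟩ : ∃ δ : ℝ, 0 < δ ∧ ∀ k ∈ evenExponents n, δ ≤ d k := by
      rcases (evenExponents n).eq_empty_or_nonempty with he | hne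
      · exact ⟨1, one_pos, by simp [he]⟩
      · obtain ⟨k, hk, hmin⟩ := (evenExponents_finite n).exists_minimalFor d _ hne
        refine ⟨d k, hd k hk, fun l hl => ?_⟩
        exact (le_total (d k) (d l)).elim id fun h => hmin hl h
    exact ⟨δ, hδ, fun k hk => (Set.Icc_subset_Icc (by linarith [hle k hk])
      (by linarith [hle k hk])).trans (hsub k hk)⟩
  · rintro k hk ⟨-, hpsd⟩
    have hqneg : q ε < 0 := hneg (by simpa [abs_of_pos hε] using hεlt)
    have h := (hpsd.hadamard ((cosMatrixPerturbed_posSemidef n hε.le).hadamard_pow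
      (n - 2 - k))).dotProduct_mulVec_nonneg fun i => (-1 : ℝ) ^ (i : ℕ)
    rw [star_trivial, dotProduct_mulVec_eq_sum_sum] at h
    simp only [hadamard_apply, absHadamardPow, of_apply, abs_rpow_sub_one_mul_pow hk] at h
    exact absurd h hqneg.not_ge
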